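/- **Model.** Let $\mathcal S,\mathcal V,\mathcal A_A$ be finite nonempty sets (semantic statuses, contexts, decision actions). The state is $W_t=(X_t,\hat X_t,\Phi_t)\in\mathcal I=\mathcal S\times\mathcal S\times\mathcal V$. A sampler uses a deterministic policy $a_S(t)=\pi_S(W_t)\in\{0,1\}$ and a decision-maker, who observes only the estimate $\hat X_t$, uses a deterministic policy $a_A(t)=\pi_A(\hat X_t)\in\mathcal A_A$. Given $W_t=(i,j,k)$ and the actions $(s,m)$, the variables $X_{t+1},\hat X_{t+1},\Phi_{t+1}$ are conditionally independent: $X_{t+1}=u$ with probability $p^{(k,m)}_{i,u}$; $\Phi_{t+1}=r$ with probability $p_{k,r}$; if $s=0$ then $\hat X_{t+1}=j$, and if $s=1$ then $\hat X_{t+1}=i$ with probability $p_S\in[0,1]$ (successful transmission) and $\hat X_{t+1}=j$ otherwise. The instantaneous cost is $\mathrm{GoT}^{\pi_A}(t)+C_S\,a_S(t)$, where $$\mathrm{GoT}^{\pi_A}(t)=\bigl[C_1(X_t,\Phi_t)-a\,C_2(\pi_A(\hat X_t))\bigr]^+ + b\,C_3(\pi_A(\hat X_t)),$$ with real-valued $C_1,C_2,C_3$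 and real constants $a,b,C_S$. A pair $(\pi_S^*,\pi_A^*)$ of deterministic policies is *optimal* if, from every initial distribution, it minimizes $$\limsup_{T\to\infty}\frac1T\,\mathbb E^{(\pi_S,\pi_A)}\Bigl[\sum_{t=0}^{T-1}\bigl(\mathrm{GoT}^{\pi_A}(t)+C_S a_S(t)\bigr)\Bigr]$$ over all pairs $(\pi_S,\pi_A)$ of deterministic policies. **Sampling MDPs.** Fixing $\pi_A$ gives a finite MDP $\mathscr M^{\pi_A}$ with states $\mathcal I$, actions $\{0,1\}$, transition function $p^{\pi_A}(w'\mid w,a_S)=p(w'\mid w,(a_S,\pi_A(\hat x)))$ for $w=(x,\hat x,\phi)$, and reward $R^{\pi_A}=-(\mathrm{GoT}^{\pi_A}+C_S a_S)$. It is *unichain* if every deterministic stationary policy induces a Markov chain with a single recurrent class (plus possibly transient states). It is *weakly communicating* if there is a closed set of states, each accessible from each other under some deterministic stationary policy, while every other state is transient under all such policies. Every unichain MDP is weakly communicating. **Algorithm.** For each of the finitely many $\pi_A$, an inner procedure applied to $\mathscr M^{\pi_A}$ returns a sampling policy $\pi_S^*(\pi_A)$ and an average reward $\theta_{\pi_A}$.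 The algorithm then takes $\pi_A^*$ with the smallest average cost $-\theta_{\pi_A}$, and outputs $(\pi_S^*(\pi_A^*),\pi_A^*)$; ties are broken arbitrarily. For $V:\mathcal I\to\mathbb R$ put $Q_V(w,a_S)=R^{\pi_A}(w,a_S)+\sum_{w'}p^{\pi_A}(w'\mid w,a_S)V(w')$. The inner procedure is one of the following. * *Exact.* Take any solution $(\theta,V)$ of the Bellman equation $\theta+V(w)=\max_{a_S}Q_V(w,a_S)$, $w\in\mathcal I$; return $\theta$ and any policy $\pi_S$ with $\pi_S(w)\in\arg\max_{a_S}Q_V(w,a_S)$ for all $w$. * *RVI with tolerance $\epsilon>0$ and an arbitrary reference state $w^{\rm ref}$ (which may depend on $\pi_A$).* Put $V^0=0$ and, for $k\ge1$, $V^k(w^{\rm ref})=0$ and $$V^k(w)=-g_k+\max_{a_S}\Bigl\{R^{\pi_A}(w,a_S)+\sum_{w'\ne w^{\rm ref}}p^{\pi_A}(w'\mid w,a_S)V^{k-1}(w')\Bigr\}\quad(w\neq w^{\rm ref}),$$ where $g_k$ is the value of the same maximum at $w=w^{\rm ref}$. Stop at the first $k\ge1$ with $\|V^k-V^{k-1}\|_\infty<\epsilon$;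 return $\theta=-V^k(w)+\max_{a_S}Q_{V^k}(w,a_S)$ for an arbitrarily chosen $w$, and any policy $\pi_S$ with $\pi_S(w)\in\arg\max_{a_S}Q_{V^k}(w,a_S)$ for all $w$. **Theorem.** Assume that for every deterministic decision-making policy $\pi_A$ the MDP $\mathscr M^{\pi_A}$ is weakly communicating (in particular, this holds if every $\mathscr M^{\pi_A}$ is unichain). Then: 1. With exact inner procedure the algorithm has an output (every Bellman equation is solvable), and every output $(\pi_S^*,\pi_A^*)$ is optimal. 2. There is $\epsilon_0>0$, depending only on the model, such that for all $0<\epsilon<\epsilon_0$ and all choices of reference states, every output $(\pi_S^*,\pi_A^*)$ of the algorithm with RVI inner procedure (that is, whenever all RVI loops stop) is optimal. 3. If in addition, for all deterministic $\pi_A$ and $\pi_S$, every recurrent state of the induced Markov chain has period $1$, then for every $\epsilon>0$ and all choices of reference states all RVI loops stop, so that the algorithm with RVI inner procedure has an output. -/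

import Mathlib

open Filter

/-! ## Finite Markov chains -/

namespace MarkovChain

variable {I : Type*} [Fintype I] [DecidableEq I]

/-- `w'` is accessible from `w`: the `n`-step transition probability is positive for some `n ≥ 0`. -/
def Accessible (P : Matrix I I ℝ) (w w' : I) : Prop :=
  ∃ n : ℕ, 0 < (P ^ n) w w'

/-- A state of a finite chain is recurrent when it is accessible from every state accessible
from it. -/
def Recurrent (P : Matrix I I ℝ) (w : I) : Prop :=
  ∀ w', Accessible P w w' → Accessible P w' w

/-- A state of a finite chain is transient when it is not recurrent. -/
def Transient (P : Matrix I I ℝ) (w : I) : Prop :=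
  ¬ Recurrent P w

/-- The chain consists of a single recurrent class and possibly some transient states. -/
def IsUnichain (P : Matrix I I ℝ) : Prop :=
  ∀ w w', Recurrent P w → Recurrent P w' → Accessible P w w'

/-- Every recurrent state has period one: the only common divisor of its possible return times
is `1`. -/
def IsAperiodic (P : Matrix I I ℝ) : Prop :=
  ∀ w, Recurrent P w → ∀ d : ℕ, (∀ n : ℕ, 0 < n → 0 < (P ^ n) w w → d ∣ n) → d = 1

/-- The law of the path `(W_0, …, W_T)` of the chain with initial law `μ`. -/
def pathProb (P : Matrix I I ℝ) (μ : I → ℝ) (T : ℕ) (ω : Fin (T + 1) → I) : ℝ :=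
  μ (ω 0) * ∏ t : Fin T, P (ω t.castSucc) (ω t.succ)

/-- The expectation of `∑_{t=0}^{T-1} c(W_t)` for the chain with initial law `μ`. -/
def expectedTotal (P : Matrix I I ℝ) (μ : I → ℝ) (c : I → ℝ) (T : ℕ) : ℝ :=
  ∑ ω : Fin (T + 1) → I, pathProb P μ T ω * ∑ t : Fin T, c (ω t.castSucc)

/-- The long-run average `limsup_{T → ∞} (1/T) E[∑_{t=0}^{T-1} c(W_t)]`. -/
noncomputable def longRunAverage (P : Matrix I I ℝ) (μ : I → ℝ) (c : I → ℝ) : ℝ :=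
  limsup (fun T : ℕ => (1 / (T : ℝ)) * expectedTotal P μ c T) atTop

end MarkovChain

/-! ## Finite Markov decision processes with the average-reward criterion -/

/-- A finite Markov decision process with states `I` and actions `B`. -/
structure FiniteMDP (I B : Type*) [Fintype I] where
  /-- `trans w b w'` is the probability of moving from `w` to `w'` under the action `b`. -/
  trans : I → B → I → ℝ
  /-- The one-step reward. -/
  reward : I → B → ℝ
  trans_nonneg : ∀ w b w', 0 ≤ trans w b w'
  trans_sum : ∀ w b, ∑ w', trans w b w' = 1

namespace FiniteMDP

variable {I B : Type*} [Fintype I] [DecidableEq I]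

/-- The transition matrix under the deterministic stationary policy `σ`. -/
def chain (M : FiniteMDP I B) (σ : I → B) : Matrix I I ℝ :=
  Matrix.of fun w w' => M.trans w (σ w) w'

/-- The MDP is unichain: every deterministic stationary policy induces a unichain Markov chain. -/
def IsUnichain (M : FiniteMDP I B) : Prop :=
  ∀ σ : I → B, MarkovChain.IsUnichain (M.chain σ)

/-- The MDP is weakly communicating: there is a closed set `C` of states, each accessible from
each other under some deterministic stationary policy, and all the other states are transient under
every such policy. -/
def IsWeaklyCommunicating (M : FiniteMDP I B) : Prop :=
  ∃ C : Set I,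
    (∀ w ∈ C, ∀ b w', 0 < M.trans w b w' → w' ∈ C) ∧
    (∀ w ∈ C, ∀ w' ∈ C, ∃ σ : I → B, MarkovChain.Accessible (M.chain σ) w w') ∧
    (∀ w, w ∉ C → ∀ σ : I → B, MarkovChain.Transient (M.chain σ) w)

/-- Every deterministic stationary policy induces an aperiodic Markov chain. -/
def IsAperiodic (M : FiniteMDP I B) : Prop :=
  ∀ σ : I → B, MarkovChain.IsAperiodic (M.chain σ)

/-- `R(w,b) + ∑_{w'} p(w'|w,b) V(w')`. -/
def lookahead (M : FiniteMDP I B) (V : I → ℝ) (w : I) (b : B) : ℝ :=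
  M.reward w b + ∑ w', M.trans w b w' * V w'

/-- The average-reward Bellman optimality equation
`θ + V(w) = max_b {R(w,b) + ∑_{w'} p(w'|w,b) V(w')}`. -/
def SolvesBellman (M : FiniteMDP I B) (θ : ℝ) (V : I → ℝ) : Prop :=
  ∀ w, θ + V w = ⨆ b, M.lookahead V w b

/-- `σ(w)` is a maximiser of `b ↦ R(w,b) + ∑_{w'} p(w'|w,b) V(w')` at every state `w`. -/
def IsGreedy (M : FiniteMDP I B) (V : I → ℝ) (σ : I → B) : Prop :=
  ∀ w b, M.lookahead V w b ≤ M.lookahead V w (σ w)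

/-- `max_b {R(w,b) + ∑_{w' ≠ ref} p(w'|w,b) V(w')}`. -/
noncomputable def rviBackup (M : FiniteMDP I B) (ref : I) (V : I → ℝ) (w : I) : ℝ :=
  ⨆ b, (M.reward w b + ∑ w' ∈ Finset.univ.erase ref, M.trans w b w' * V w')

/-- The iterates of relative value iteration with reference state `ref`, started at `0`. The value
at `ref` is kept at `0`, and the offset subtracted elsewhere is the backup at `ref`. -/
noncomputable def rvi (M : FiniteMDP I B) (ref : I) : ℕ → I → ℝ
  | 0 => fun _ => 0
  | k + 1 => fun w =>
      if w = ref then 0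
      else -M.rviBackup ref (M.rvi ref k) ref + M.rviBackup ref (M.rvi ref k) w

/-- The loop of relative value iteration stops after exactly `k` passes: `k ≥ 1` is the first
index at which two successive iterates are closer than `ε` in the supremum norm. -/
def RVIStopsAt (M : FiniteMDP I B) (ref : I) (ε : ℝ) (k : ℕ) : Prop :=
  1 ≤ k ∧ ‖M.rvi ref k - M.rvi ref (k - 1)‖ < ε ∧
    ∀ j, 1 ≤ j → j < k → ε ≤ ‖M.rvi ref j - M.rvi ref (j - 1)‖

/-- Relative value iteration with reference state `ref` and tolerance `ε` terminates and may return
the policy `σ` and the average reward `θ`: with `V` the last iterate, `σ` is greedy for `V`, and `θ`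
is `-V(w) + max_b {R(w,b) + ∑_{w'} p(w'|w,b) V(w')}`, read off at some state `w`. -/
def IsRVIOutput (M : FiniteMDP I B) (ref : I) (ε : ℝ) (σ : I → B) (θ : ℝ) : Prop :=
  ∃ k, M.RVIStopsAt ref ε k ∧
    (∃ w, θ = -M.rvi ref k w + ⨆ b, M.lookahead (M.rvi ref k) w b) ∧
    M.IsGreedy (M.rvi ref k) σ

end FiniteMDP

/-! ### Unichain MDPs are weakly communicating -/

namespace FiniteMDP

variable {I B : Type*} [Fintype I] [DecidableEq I]

theorem chain_pow_nonneg (M : FiniteMDP I B) (σ : I → B) (n : ℕ) (w w' : I) :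
    0 ≤ (M.chain σ ^ n) w w' := by
  induction n generalizing w' with
  | zero =>
    rw [pow_zero, Matrix.one_apply]
    split <;> norm_num
  | succ n ih =>
    rw [pow_succ, Matrix.mul_apply]
    exact Finset.sum_nonneg fun x _ => mul_nonneg (ih x) (M.trans_nonneg _ _ _)

theorem accessible_iff (M : FiniteMDP I B) (σ : I → B) (w w' : I) :
    MarkovChain.Accessible (M.chain σ) w w' ↔
      Relation.ReflTransGen (fun x y => 0 < M.trans x (σ x) y) w w' := by
  constructor
  · rintro ⟨n, hn⟩
    induction n generalizing w' with
    | zero =>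
      rw [pow_zero, Matrix.one_apply] at hn
      split at hn
      · next h => exact h ▸ Relation.ReflTransGen.refl
      · exact absurd hn (lt_irrefl 0)
    | succ n ih =>
      rw [pow_succ, Matrix.mul_apply] at hn
      obtain ⟨x, -, hx⟩ := Finset.exists_lt_of_sum_lt (s := Finset.univ)
        (f := fun _ : I => (0 : ℝ)) (by simpa using hn)
      have h1 : 0 < (M.chain σ ^ n) w x :=
        lt_of_le_of_ne (M.chain_pow_nonneg σ n w x) fun h => by simp [← h] at hx
      exact (ih x h1).tail (pos_of_mul_pos_right hx h1.le)
  · intro h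
    induction h with
    | refl => exact ⟨0, by simp⟩
    | @tail x y _ hxy ih =>
      obtain ⟨n, hn⟩ := ih
      refine ⟨n + 1, ?_⟩
      rw [pow_succ, Matrix.mul_apply]
      exact Finset.sum_pos' (fun z _ => mul_nonneg (M.chain_pow_nonneg σ n w z)
        (M.trans_nonneg _ _ _)) ⟨x, Finset.mem_univ _, mul_pos hn hxy⟩

theorem exists_recurrent (M : FiniteMDP I B) (σ : I → B) (w : I) :
    ∃ w', MarkovChain.Accessible (M.chain σ) w w' ∧ MarkovChain.Recurrent (M.chain σ) w' := by
  classical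
  have hne : (Finset.univ.filter fun x => MarkovChain.Accessible (M.chain σ) w x).Nonempty :=
    ⟨w, by simpa using (M.accessible_iff σ w w).2 .refl⟩
  obtain ⟨x, hx, hmin⟩ := Finset.exists_min_image _
    (fun x => (Finset.univ.filter fun y => MarkovChain.Accessible (M.chain σ) x y).card) hne
  simp only [Finset.mem_filter, Finset.mem_univ, true_and] at hx hmin
  refine ⟨x, hx, fun y hy => ?_⟩
  simp only [accessible_iff] at *
  have hsub : (Finset.univ.filter fun z =>
        Relation.ReflTransGen (fun x y => 0 < M.trans x (σ x) y) y z) ⊆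
      Finset.univ.filter fun z =>
        Relation.ReflTransGen (fun x y => 0 < M.trans x (σ x) y) x z := by
    intro z hz
    simp only [Finset.mem_filter, Finset.mem_univ, true_and] at hz ⊢
    exact hy.trans hz
  have heq := Finset.eq_of_subset_of_card_le hsub (hmin y (hx.trans hy))
  have hxx : x ∈ Finset.univ.filter fun z =>
      Relation.ReflTransGen (fun x y => 0 < M.trans x (σ x) y) x z := by
    simp [Relation.ReflTransGen.refl]
  rw [← heq] at hxx
  simpa using hxx

/-- Every unichain MDP is weakly communicating. -/
theorem IsUnichain.isWeaklyCommunicating {M : FiniteMDP I B} (hM : M.IsUnichain) :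
    M.IsWeaklyCommunicating := by
  have key : ∀ (σ : I → B) (s : I), MarkovChain.Recurrent (M.chain σ) s →
      ∀ x, MarkovChain.Accessible (M.chain σ) x s := by
    intro σ s hs x
    obtain ⟨y, hxy, hy⟩ := M.exists_recurrent σ x
    have h := hM σ y s hy hs
    rw [accessible_iff] at *
    exact hxy.trans h
  refine ⟨{w | ∃ σ, MarkovChain.Recurrent (M.chain σ) w}, ?_, ?_, ?_⟩
  · rintro s ⟨σ, hs⟩ a s' hss'
    have hall : ∀ x, MarkovChain.Accessible (M.chain (Function.update σ s a)) x s := by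
      intro x
      have hx := key σ s hs x
      rw [accessible_iff] at hx ⊢
      induction hx using Relation.ReflTransGen.head_induction_on with
      | refl => exact .refl
      | @head y z hyz _ ih =>
        by_cases hy : y = s
        · exact hy ▸ .refl
        · exact .head (by simpa [Function.update_of_ne hy] using hyz) ih
    refine ⟨Function.update σ s a, fun y _ => ?_⟩
    have h := hall y
    rw [accessible_iff] at h ⊢
    exact h.tail (by simpa using hss')
  · rintro w - w' ⟨σ, hw'⟩
    exact ⟨σ, key σ w' hw' w⟩
  · intro w hw σ hrec
    exact hw ⟨σ, hrec⟩

end FiniteMDP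

/-! ## The sampler and decision-maker model -/

/-- The data of the system: semantic statuses `S`, contexts `V`, decision actions `A`. -/
structure GoTModel (S V A : Type*) [Fintype S] [Fintype V] where
  /-- `source i k m u = Pr(X_{t+1} = u | X_t = i, Φ_t = k, a_A(t) = m)`. -/
  source : S → V → A → S → ℝ
  source_nonneg : ∀ i k m u, 0 ≤ source i k m u
  source_sum : ∀ i k m, ∑ u, source i k m u = 1
  /-- `context k r = Pr(Φ_{t+1} = r | Φ_t = k)`. -/
  context : V → V → ℝ
  context_nonneg : ∀ k r, 0 ≤ context k r
  context_sum : ∀ k, ∑ r, context k r = 1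
  /-- The probability that a transmission succeeds. -/
  pS : ℝ
  pS_nonneg : 0 ≤ pS
  pS_le_one : pS ≤ 1
  /-- The status inherent cost. -/
  C₁ : S → V → ℝ
  /-- The actuation gain. -/
  C₂ : A → ℝ
  /-- The actuation resource expenditure. -/
  C₃ : A → ℝ
  /-- The weight of the actuation gain. -/
  a : ℝ
  /-- The weight of the actuation resource expenditure. -/
  b : ℝ
  /-- The cost of one sampling and transmission. -/
  CS : ℝ

namespace GoTModel

variable {S V A : Type*} [Fintype S] [DecidableEq S] [Fintype V] [DecidableEq V]

/-- Global states `(X_t, X̂_t, Φ_t)`. -/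
abbrev State (S V : Type*) : Type _ := S × S × V

/-- Sampling actions: `1` is sampling and transmission, `0` is idling. -/
abbrev Sampling : Type := Fin 2

/-- Deterministic sampling policies `a_S(t) = π_S(X_t, X̂_t, Φ_t)`. -/
abbrev SamplingPolicy (S V : Type*) : Type _ := State S V → Sampling

/-- Deterministic decision-making policies `a_A(t) = π_A(X̂_t)`. -/
abbrev DecisionPolicy (S A : Type*) : Type _ := S → A

/-- `Pr(X̂_{t+1} = x | X_t = i, X̂_t = j, a_S(t) = s)`. -/
def estimate (M : GoTModel S V A) (i j : S) (s : Sampling) (x : S) : ℝ :=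
  if s = 1 then
    M.pS * (if x = i then 1 else 0) + (1 - M.pS) * (if x = j then 1 else 0)
  else if x = j then 1 else 0

/-- The transition function `p(w' | w, (a_S, a_A))` of the Dec-POMDP. -/
def trans (M : GoTModel S V A) (w : State S V) (s : Sampling) (m : A) (w' : State S V) : ℝ :=
  M.source w.1 w.2.2 m w'.1 * M.context w.2.2 w'.2.2 * M.estimate w.1 w.2.1 s w'.2.1

/-- The observation function of the decision-maker, who observes `X̂_t` only. -/
def obsA (w : State S V) (o : S) : ℝ :=
  if o = w.2.1 then 1 else 0

/-- The transition function `∑_o p(w' | w, (a_S, π_A(o))) p_A(o | w)` of the sampling MDP. -/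
def inducedTrans (M : GoTModel S V A) (πA : DecisionPolicy S A)
    (w : State S V) (s : Sampling) (w' : State S V) : ℝ :=
  ∑ o : S, M.trans w s (πA o) w' * obsA w o

/-- The goal-oriented tensor `[C₁(X,Φ) - a C₂(π_A(X̂))]⁺ + b C₃(π_A(X̂))`. -/
noncomputable def got (M : GoTModel S V A) (πA : DecisionPolicy S A) (w : State S V) : ℝ :=
  max (M.C₁ w.1 w.2.2 - M.a * M.C₂ (πA w.2.1)) 0 + M.b * M.C₃ (πA w.2.1)

/-- The instantaneous cost `GoT + C_S a_S`. -/
noncomputable def cost (M : GoTModel S V A) (πA : DecisionPolicy S A)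
    (w : State S V) (s : Sampling) : ℝ :=
  M.got πA w + M.CS * ((s : ℕ) : ℝ)

theorem estimate_nonneg (M : GoTModel S V A) (i j : S) (s : Sampling) (x : S) :
    0 ≤ M.estimate i j s x := by
  have h0 := M.pS_nonneg
  have h1 := sub_nonneg.2 M.pS_le_one
  unfold estimate
  positivity

theorem estimate_sum (M : GoTModel S V A) (i j : S) (s : Sampling) :
    ∑ x, M.estimate i j s x = 1 := by
  unfold estimate
  split
  · simp [Finset.sum_add_distrib]
  · simp

theorem inducedTrans_eq (M : GoTModel S V A) (πA : DecisionPolicy S A)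
    (w : State S V) (s : Sampling) (w' : State S V) :
    M.inducedTrans πA w s w' = M.trans w s (πA w.2.1) w' := by
  simp [inducedTrans, obsA]

theorem trans_nonneg (M : GoTModel S V A) (w : State S V) (s : Sampling) (m : A)
    (w' : State S V) : 0 ≤ M.trans w s m w' :=
  mul_nonneg (mul_nonneg (M.source_nonneg _ _ _ _) (M.context_nonneg _ _))
    (M.estimate_nonneg _ _ _ _)

theorem trans_sum (M : GoTModel S V A) (w : State S V) (s : Sampling) (m : A) :
    ∑ w', M.trans w s m w' = 1 := by
  simp only [trans, Fintype.sum_prod_type]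
  have h : ∀ u x, ∑ r, M.source w.1 w.2.2 m u * M.context w.2.2 r * M.estimate w.1 w.2.1 s x
      = M.source w.1 w.2.2 m u * M.estimate w.1 w.2.1 s x := by
    intro u x
    rw [← Finset.sum_mul, ← Finset.mul_sum, M.context_sum, mul_one]
  simp only [h, ← Finset.mul_sum, M.estimate_sum, mul_one, M.source_sum]

/-- The fully observed MDP faced by the sampler when the decision-making policy is `πA`; its reward
is minus the instantaneous cost. -/
noncomputable def samplingMDP (M : GoTModel S V A) (πA : DecisionPolicy S A) :
    FiniteMDP (State S V) Sampling where
  trans := M.inducedTrans πA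
  reward := fun w s => -M.cost πA w s
  trans_nonneg := fun w s w' => by
    rw [inducedTrans_eq]; exact M.trans_nonneg _ _ _ _
  trans_sum := fun w s => by
    simp only [inducedTrans_eq]; exact M.trans_sum _ _ _

/-- The transition matrix of `W_t` when both agents act: `a_S(t) = πS(W_t)`, `a_A(t) = πA(X̂_t)`. -/
def jointChain (M : GoTModel S V A) (πS : SamplingPolicy S V) (πA : DecisionPolicy S A) :
    Matrix (State S V) (State S V) ℝ :=
  Matrix.of fun w w' => M.trans w (πS w) (πA w.2.1) w'

/-- The long-run average cost
`limsup_{T → ∞} (1/T) E[∑_{t=0}^{T-1} (GoT(t) + C_S a_S(t))]` of the joint policy `(πS, πA)` from the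
initial law `μ`. -/
noncomputable def avgCost (M : GoTModel S V A) (μ : State S V → ℝ)
    (πS : SamplingPolicy S V) (πA : DecisionPolicy S A) : ℝ :=
  MarkovChain.longRunAverage (M.jointChain πS πA) μ fun w => M.cost πA w (πS w)

/-- `(πS, πA)` minimises the long-run average cost among all joint deterministic policies, from
every initial law. -/
def IsOptimal (M : GoTModel S V A) (πS : SamplingPolicy S V) (πA : DecisionPolicy S A) : Prop :=
  ∀ μ ∈ stdSimplex ℝ (State S V), ∀ (πS' : SamplingPolicy S V) (πA' : DecisionPolicy S A),
    M.avgCost μ πS πA ≤ M.avgCost μ πS' πA'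

/-- The last step of the brute-force search. `σ πA` and `θ πA` are the sampling policy and the
average reward returned for `πA`; a decision-making policy with the least average cost `-θ` is
selected, together with its sampling policy. -/
def IsSearchResult (σ : DecisionPolicy S A → SamplingPolicy S V) (θ : DecisionPolicy S A → ℝ)
    (πS : SamplingPolicy S V) (πA : DecisionPolicy S A) : Prop :=
  (∀ πA', -θ πA ≤ -θ πA') ∧ πS = σ πA

/-- `(πS, πA)` is a possible output of the brute-force search in which each sampling MDP is solved
exactly: for every `πA'` a solution `(θ, V)` of the Bellman equation and a sampling policy that is
greedy for `V` are computed. -/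
def IsExactBruteForceOutput (M : GoTModel S V A)
    (πS : SamplingPolicy S V) (πA : DecisionPolicy S A) : Prop :=
  ∃ (σ : DecisionPolicy S A → SamplingPolicy S V) (θ : DecisionPolicy S A → ℝ),
    (∀ πA', ∃ Vf : State S V → ℝ,
      (M.samplingMDP πA').SolvesBellman (θ πA') Vf ∧ (M.samplingMDP πA').IsGreedy Vf (σ πA')) ∧
    IsSearchResult σ θ πS πA

/-- `(πS, πA)` is a possible output of the brute-force search in which each sampling MDP is treated
by relative value iteration with tolerance `ε`, with reference state `ref πA'` for `πA'`. In
particular all these iterations terminate. -/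
def IsRVIBruteForceOutput (M : GoTModel S V A) (ref : DecisionPolicy S A → State S V) (ε : ℝ)
    (πS : SamplingPolicy S V) (πA : DecisionPolicy S A) : Prop :=
  ∃ (σ : DecisionPolicy S A → SamplingPolicy S V) (θ : DecisionPolicy S A → ℝ),
    (∀ πA', (M.samplingMDP πA').IsRVIOutput (ref πA') ε (σ πA') (θ πA')) ∧
    IsSearchResult σ θ πS πA

end GoTModel

/-! For a fixed decision policy the joint problem is the sampling MDP (`avgCost_eq`), so everything
reduces to average-reward theory for finitely many finite MDPs.

If `(θ, V)` solves the Bellman equation, iterating it along a policy makes the bounded `V`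
telescope. Every sampling policy then costs at least `-θ`, and a greedy one exactly `-θ`, whatever
the initial law. Because this number does not depend on the start, comparing the values `-θ` over
decision policies settles optimality from all starts at once.

Solvability comes from a vanishing discount: discounted values have uniformly bounded oscillation
(`IsWeaklyCommunicating.exists_span_bound`), so a compactness argument lets the discount factor tend
to one.

A stopped relative value iteration yields a function satisfying the Bellman equation up to `ε` for
some constant gain, so the returned policy and value are accurate to order `ε`
(`IsRVIOutput.near_optimal`). There are finitely many policies and starting states, hence finitely
many costs, and a cost close enough to the optimum from above cannot exceed it (`exists_gap_above`).

Stopping under aperiodicity rests on `IsAperiodic.tendsto_iterate`. Subtracting `h + nθ`, with `(θ,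
h)` a Bellman solution, makes all rewards nonpositive with zero attained. If limsup and liminf of
the iterates differed, the gap would be constant on a recurrent class of a policy greedy for the
limsup; aperiodic mixing there would lift the iterates strictly above the liminf for good. -/

/-! ## Long-run averages of finite chains -/

namespace MarkovChain

variable {I : Type*} [Fintype I]

/-- The expectation of `∑_{t=0}^{T-1} c(W_t)` for the chain started at a given state, defined by
conditioning on the first step. -/
def totalFrom (P : Matrix I I ℝ) (c : I → ℝ) : ℕ → I → ℝ
  | 0 => fun _ => 0
  | T + 1 => fun w => c w + ∑ w', P w w' * totalFrom P c T w'

theorem sum_path_succ {T : ℕ} (F : (Fin (T + 1 + 1) → I) → ℝ) :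
    ∑ ω, F ω = ∑ w : I, ∑ ω : Fin (T + 1) → I, F (Fin.cons w ω) := by
  rw [← Fintype.sum_prod_type']
  exact (Fintype.sum_equiv (Fin.consEquiv fun _ => I) _ _ fun _ => rfl).symm

-- After the first state, the rest of the path starts from the law `P w`. Inductions on the horizon
-- therefore have to range over all `μ`.
omit [Fintype I] in
theorem pathProb_cons (P : Matrix I I ℝ) (μ : I → ℝ) (T : ℕ) (w : I) (ω : Fin (T + 1) → I) :
    pathProb P μ (T + 1) (Fin.cons w ω) = μ w * pathProb P (P w) T ω := by
  simp only [pathProb, Fin.prod_univ_succ (n := T), Fin.cons_zero, Fin.castSucc_zero,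
    Fin.cons_succ, Fin.castSucc_succ]

theorem sum_pathProb {P : Matrix I I ℝ} (hP : ∀ w, ∑ w', P w w' = 1) (T : ℕ) (μ : I → ℝ) :
    ∑ ω, pathProb P μ T ω = ∑ w, μ w := by
  induction T generalizing μ with
  | zero =>
    exact Fintype.sum_equiv (Equiv.funUnique (Fin 1) I) _ _ fun ω => by simp [pathProb]
  | succ T ih =>
    rw [sum_path_succ]
    simp only [pathProb_cons, ← Finset.mul_sum, ih, hP, mul_one]

theorem expectedTotal_eq {P : Matrix I I ℝ} (hP : ∀ w, ∑ w', P w w' = 1) (c : I → ℝ) (T : ℕ)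
    (μ : I → ℝ) : expectedTotal P μ c T = ∑ w, μ w * totalFrom P c T w := by
  induction T generalizing μ with
  | zero => simp [expectedTotal, totalFrom]
  | succ T ih =>
    have ih' : ∀ w, ∑ ω : Fin (T + 1) → I, pathProb P (P w) T ω * ∑ t : Fin T, c (ω t.castSucc) =
        ∑ w', P w w' * totalFrom P c T w' := fun w => ih (P w)
    rw [expectedTotal, sum_path_succ]
    refine Finset.sum_congr rfl fun w _ => ?_
    simp only [pathProb_cons, Fin.sum_univ_succ (n := T), Fin.castSucc_zero, Fin.cons_zero,
      Fin.castSucc_succ, Fin.cons_succ, mul_add, mul_assoc, Finset.sum_add_distrib,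
      ← Finset.mul_sum, ← Finset.sum_mul, sum_pathProb hP, hP, ih', totalFrom, one_mul]

variable {P : Matrix I I ℝ} {c : I → ℝ}

/-- Iterating the one-step inequality telescopes `V`; only its initial value and the expected
terminal value, at most `K`, survive. -/
theorem le_totalFrom (hP0 : ∀ w w', 0 ≤ P w w') (hP : ∀ w, ∑ w', P w w' = 1) {κ K : ℝ}
    {V : I → ℝ} (hV : ∀ w, κ + V w ≤ c w + ∑ w', P w w' * V w') (hK : ∀ w, V w ≤ K) (T : ℕ)
    (w : I) : T * κ + V w - K ≤ totalFrom P c T w := by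
  induction T generalizing w with
  | zero => simpa [totalFrom] using hK w
  | succ T ih =>
    have h1 : ∑ w', P w w' * (T * κ + V w' - K) ≤ ∑ w', P w w' * totalFrom P c T w' :=
      Finset.sum_le_sum fun w' _ => mul_le_mul_of_nonneg_left (ih w') (hP0 w w')
    have h2 : ∑ w', P w w' * (T * κ + V w' - K) = T * κ - K + ∑ w', P w w' * V w' := by
      simp only [mul_sub, mul_add, Finset.sum_add_distrib, Finset.sum_sub_distrib,
        ← Finset.sum_mul, hP]
      ring
    have h3 := hV w
    simp only [totalFrom]
    push_cast
    linarith

theorem totalFrom_neg (T : ℕ) (w : I) :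
    totalFrom P (fun x => -c x) T w = -totalFrom P c T w := by
  induction T generalizing w with
  | zero => simp [totalFrom]
  | succ T ih => simp only [totalFrom, ih, mul_neg, Finset.sum_neg_distrib]; ring

theorem totalFrom_le (hP0 : ∀ w w', 0 ≤ P w w') (hP : ∀ w, ∑ w', P w w' = 1) {κ K : ℝ}
    {V : I → ℝ} (hV : ∀ w, c w + ∑ w', P w w' * V w' ≤ κ + V w) (hK : ∀ w, -V w ≤ K) (T : ℕ)
    (w : I) : totalFrom P c T w ≤ T * κ + V w + K := by
  have h := le_totalFrom (c := fun x => -c x) (κ := -κ) (V := fun x => -V x) hP0 hP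
    (fun w => by
      have := hV w
      simp only [mul_neg, Finset.sum_neg_distrib]
      linarith) hK T w
  rw [totalFrom_neg] at h
  linarith

/-- The mean cost over the first `T` steps from a given state. -/
noncomputable def meanFrom (P : Matrix I I ℝ) (c : I → ℝ) (w : I) (T : ℕ) : ℝ :=
  1 / (T : ℝ) * totalFrom P c T w

theorem longRunAverage_eq (hP : ∀ w, ∑ w', P w w' = 1) (μ : I → ℝ) :
    longRunAverage P μ c = limsup (fun T => ∑ w, μ w * meanFrom P c w T) atTop := by
  simp only [longRunAverage, expectedTotal_eq hP, meanFrom, Finset.mul_sum]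
  congr 1
  funext T
  exact Finset.sum_congr rfl fun w _ => by ring

/-- The telescoping bounds with `V = 0`. Real-valued `limsup` is only meaningful for bounded
sequences, so all later comparisons need this. -/
theorem exists_abs_meanFrom_le (hP0 : ∀ w w', 0 ≤ P w w') (hP : ∀ w, ∑ w', P w w' = 1) :
    ∃ K, ∀ w T, |meanFrom P c w T| ≤ K := by
  obtain ⟨K, hK⟩ := (Set.finite_range fun w => |c w|).bddAbove
  have hK' : ∀ w, |c w| ≤ K := fun w => hK ⟨w, rfl⟩
  refine ⟨K, fun w T => ?_⟩
  have hc := fun w => abs_le.1 (hK' w)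
  have h1 := totalFrom_le (c := c) (κ := K) (K := 0) (V := fun _ => 0) hP0 hP
    (fun w => by simpa using (hc w).2) (by simp) T w
  have h2 := le_totalFrom (c := c) (κ := -K) (K := 0) (V := fun _ => 0) hP0 hP
    (fun w => by simpa using (hc w).1) (by simp) T w
  rcases T.eq_zero_or_pos with rfl | hT
  · simpa [meanFrom] using (abs_nonneg _).trans (hK' w)
  · have hT' : (0 : ℝ) < T := by exact_mod_cast hT
    rw [meanFrom, abs_le, one_div, inv_mul_eq_div, le_div_iff₀ hT', div_le_iff₀ hT']
    constructor <;> linarith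

theorem abs_sum_mul_le {μ f : I → ℝ} (hμ : μ ∈ stdSimplex ℝ I) {K : ℝ} (hf : ∀ w, |f w| ≤ K) :
    |∑ w, μ w * f w| ≤ K := by
  calc |∑ w, μ w * f w| ≤ ∑ w, |μ w * f w| := Finset.abs_sum_le_sum_abs _ _
    _ ≤ ∑ w, μ w * K := Finset.sum_le_sum fun w _ => by
        rw [abs_mul, abs_of_nonneg (hμ.1 w)]
        exact mul_le_mul_of_nonneg_left (hf w) (hμ.1 w)
    _ = K := by rw [← Finset.sum_mul, hμ.2, one_mul]

theorem tendsto_natCast_add_div (κ K : ℝ) :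
    Tendsto (fun T : ℕ => 1 / (T : ℝ) * (T * κ + K)) atTop (nhds κ) := by
  have h : Tendsto (fun T : ℕ => κ + K / (T : ℝ)) atTop (nhds (κ + 0)) :=
    tendsto_const_nhds.add (tendsto_const_div_atTop_nhds_zero_nat K)
  rw [add_zero] at h
  refine h.congr' ?_
  filter_upwards [eventually_gt_atTop 0] with T hT
  have : (T : ℝ) ≠ 0 := by positivity
  field_simp

section Bounds

variable (hP0 : ∀ w w', 0 ≤ P w w') (hP : ∀ w, ∑ w', P w w' = 1)
include hP0 hP

theorem isBoundedUnder_mean {μ : I → ℝ} (hμ : μ ∈ stdSimplex ℝ I) :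
    IsBoundedUnder (· ≤ ·) atTop (fun T => ∑ w, μ w * meanFrom P c w T) ∧
      IsBoundedUnder (· ≥ ·) atTop (fun T => ∑ w, μ w * meanFrom P c w T) := by
  obtain ⟨K, hK⟩ := exists_abs_meanFrom_le (c := c) hP0 hP
  have h := fun T => abs_le.1 (abs_sum_mul_le hμ fun w => hK w T)
  exact ⟨isBoundedUnder_of ⟨K, fun T => (h T).2⟩, isBoundedUnder_of ⟨-K, fun T => (h T).1⟩⟩

/-- The initial and terminal values of `V` cost at most `2 * K` in total, which vanishes after
division by `T`. -/
theorem le_longRunAverage {μ : I → ℝ} (hμ : μ ∈ stdSimplex ℝ I) {κ : ℝ} {V : I → ℝ}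
    (hV : ∀ w, κ + V w ≤ c w + ∑ w', P w w' * V w') : κ ≤ longRunAverage P μ c := by
  obtain ⟨K, hK⟩ := (Set.finite_range fun w => |V w|).bddAbove
  have hK' : ∀ w, |V w| ≤ K := fun w => hK ⟨w, rfl⟩
  have hb := isBoundedUnder_mean (c := c) hP0 hP hμ
  rw [longRunAverage_eq hP, ← (tendsto_natCast_add_div κ (-(2 * K))).limsup_eq]
  refine limsup_le_limsup (Eventually.of_forall fun T => ?_)
    (tendsto_natCast_add_div κ (-(2 * K))).isBoundedUnder_ge.isCoboundedUnder_le hb.1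
  calc 1 / (T : ℝ) * (T * κ + -(2 * K))
      = ∑ w, μ w * (1 / (T : ℝ) * (T * κ + -(2 * K))) := by rw [← Finset.sum_mul, hμ.2, one_mul]
    _ ≤ _ := Finset.sum_le_sum fun w _ => mul_le_mul_of_nonneg_left
        (mul_le_mul_of_nonneg_left (by
          have h1 := le_totalFrom hP0 hP hV (fun w => (abs_le.1 (hK' w)).2) T w
          have h2 := (abs_le.1 (hK' w)).1
          linarith) (by positivity)) (hμ.1 w)

theorem longRunAverage_le {μ : I → ℝ} (hμ : μ ∈ stdSimplex ℝ I) {κ : ℝ} {V : I → ℝ}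
    (hV : ∀ w, c w + ∑ w', P w w' * V w' ≤ κ + V w) : longRunAverage P μ c ≤ κ := by
  obtain ⟨K, hK⟩ := (Set.finite_range fun w => |V w|).bddAbove
  have hK' : ∀ w, |V w| ≤ K := fun w => hK ⟨w, rfl⟩
  have hb := isBoundedUnder_mean (c := c) hP0 hP hμ
  rw [longRunAverage_eq hP, ← (tendsto_natCast_add_div κ (2 * K)).limsup_eq]
  refine limsup_le_limsup (Eventually.of_forall fun T => ?_)
    hb.2.isCoboundedUnder_le (tendsto_natCast_add_div κ (2 * K)).isBoundedUnder_le
  calc ∑ w, μ w * meanFrom P c w T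
      ≤ ∑ w, μ w * (1 / (T : ℝ) * (T * κ + 2 * K)) :=
        Finset.sum_le_sum fun w _ => mul_le_mul_of_nonneg_left
        (mul_le_mul_of_nonneg_left (by
          have h1 := totalFrom_le hP0 hP hV
            (fun w => by have := (abs_le.1 (hK' w)).1; linarith) T w
          have h2 := (abs_le.1 (hK' w)).2
          linarith) (by positivity)) (hμ.1 w)
    _ = _ := by rw [← Finset.sum_mul, hμ.2, one_mul]

/-- An upper bound for the long-run averages from all states holds for all initial laws. -/
theorem longRunAverage_le_of_forall_single [DecidableEq I] {κ : ℝ}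
    (h : ∀ w, longRunAverage P (Pi.single w 1) c ≤ κ) {μ : I → ℝ} (hμ : μ ∈ stdSimplex ℝ I) :
    longRunAverage P μ c ≤ κ := by
  refine le_of_forall_pos_le_add fun η hη => ?_
  -- A `limsup` does not commute with the average over `μ`, but finitely many eventual bounds hold
  -- simultaneously and can then be averaged.
  have hw : ∀ w, ∀ᶠ T in atTop, meanFrom P c w T < κ + η := fun w => by
    have hb := (isBoundedUnder_mean (c := c) hP0 hP (single_mem_stdSimplex ℝ w)).1
    have h1 := h w
    rw [longRunAverage_eq hP] at h1
    simpa [Pi.single_apply] using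
      eventually_lt_of_limsup_lt (h1.trans_lt (lt_add_of_pos_right κ hη)) hb
  rw [longRunAverage_eq hP]
  refine limsup_le_of_le (isBoundedUnder_mean (c := c) hP0 hP hμ).2.isCoboundedUnder_le ?_
  filter_upwards [eventually_all.2 hw] with T hT
  calc ∑ w, μ w * meanFrom P c w T ≤ ∑ w, μ w * (κ + η) :=
        Finset.sum_le_sum fun w _ => mul_le_mul_of_nonneg_left (hT w).le (hμ.1 w)
    _ = κ + η := by rw [← Finset.sum_mul, hμ.2, one_mul]

end Bounds

end MarkovChain

/-! ## The Bellman equation of a weakly communicating MDP -/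

namespace FiniteMDP

variable {I B : Type*} [Fintype I]

/-- The dynamic programming operator `V ↦ max_b {R(·,b) + ∑_{w'} p(w'|·,b) V(w')}`. -/
noncomputable def backup (M : FiniteMDP I B) (V : I → ℝ) (w : I) : ℝ :=
  ⨆ b, M.lookahead V w b

theorem sum_trans_mono (M : FiniteMDP I B) (w : I) (b : B) {V W : I → ℝ} (h : ∀ x, V x ≤ W x) :
    ∑ w', M.trans w b w' * V w' ≤ ∑ w', M.trans w b w' * W w' :=
  Finset.sum_le_sum fun x _ => mul_le_mul_of_nonneg_left (h x) (M.trans_nonneg _ _ _)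

theorem sum_trans_const (M : FiniteMDP I B) (w : I) (b : B) (c : ℝ) :
    ∑ w', M.trans w b w' * c = c := by
  rw [← Finset.sum_mul, M.trans_sum, one_mul]

theorem sum_trans_add_const (M : FiniteMDP I B) (w : I) (b : B) (V : I → ℝ) (c : ℝ) :
    ∑ w', M.trans w b w' * (V w' + c) = ∑ w', M.trans w b w' * V w' + c := by
  simp only [mul_add, Finset.sum_add_distrib, sum_trans_const]

theorem abs_sum_trans_le (M : FiniteMDP I B) (w : I) (b : B) {V : I → ℝ} {K : ℝ}
    (h : ∀ x, |V x| ≤ K) : |∑ w', M.trans w b w' * V w'| ≤ K := by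
  rw [abs_le]
  constructor
  · rw [← M.sum_trans_const w b (-K)]
    exact M.sum_trans_mono w b fun x => (abs_le.1 (h x)).1
  · rw [← M.sum_trans_const w b K]
    exact M.sum_trans_mono w b fun x => (abs_le.1 (h x)).2

theorem lookahead_add_const (M : FiniteMDP I B) (V : I → ℝ) (c : ℝ) (w : I) (b : B) :
    M.lookahead (fun x => V x + c) w b = M.lookahead V w b + c := by
  simp only [lookahead, sum_trans_add_const, add_assoc]

theorem lookahead_mono (M : FiniteMDP I B) {V W : I → ℝ} (h : ∀ x, V x ≤ W x) (w : I) (b : B) :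
    M.lookahead V w b ≤ M.lookahead W w b :=
  add_le_add_right (M.sum_trans_mono w b h) _

theorem lookahead_le_backup [Finite B] (M : FiniteMDP I B) (V : I → ℝ) (w : I) (b : B) :
    M.lookahead V w b ≤ M.backup V w :=
  le_ciSup (f := M.lookahead V w) (Set.finite_range _).bddAbove b

theorem exists_lookahead_eq_backup [Finite B] [Nonempty B] (M : FiniteMDP I B) (V : I → ℝ)
    (w : I) : ∃ b, M.lookahead V w b = M.backup V w :=
  exists_eq_ciSup_of_finite

theorem IsGreedy.lookahead_eq [Finite B] [Nonempty B] {M : FiniteMDP I B} {V : I → ℝ} {σ : I → B}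
    (h : M.IsGreedy V σ) (w : I) : M.lookahead V w (σ w) = M.backup V w :=
  (M.lookahead_le_backup V w (σ w)).antisymm (ciSup_le (h w))

theorem exists_isGreedy [Finite B] [Nonempty B] (M : FiniteMDP I B) (V : I → ℝ) :
    ∃ σ, M.IsGreedy V σ := by
  choose σ hσ using M.exists_lookahead_eq_backup V
  exact ⟨σ, fun w b => hσ w ▸ M.lookahead_le_backup V w b⟩

theorem backup_mono [Finite B] [Nonempty B] (M : FiniteMDP I B) {V W : I → ℝ}
    (h : ∀ x, V x ≤ W x) (w : I) : M.backup V w ≤ M.backup W w :=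
  ciSup_le fun b => (M.lookahead_mono h w b).trans (M.lookahead_le_backup W w b)

theorem backup_add_const [Finite B] [Nonempty B] (M : FiniteMDP I B) (V : I → ℝ) (c : ℝ)
    (w : I) : M.backup (fun x => V x + c) w = M.backup V w + c := by
  refine le_antisymm (ciSup_le fun b => ?_) ?_
  · rw [lookahead_add_const]
    exact add_le_add_left (M.lookahead_le_backup V w b) c
  · obtain ⟨b, hb⟩ := M.exists_lookahead_eq_backup V w
    rw [← hb, ← lookahead_add_const]
    exact M.lookahead_le_backup _ w b

theorem exists_abs_reward_le [Finite B] (M : FiniteMDP I B) :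
    ∃ R, 0 ≤ R ∧ ∀ w b, |M.reward w b| ≤ R := by
  obtain ⟨R, hR⟩ := (Set.finite_range fun p : I × B => |M.reward p.1 p.2|).bddAbove
  exact ⟨max R 0, le_max_right _ _, fun w b => (hR ⟨(w, b), rfl⟩).trans (le_max_left _ _)⟩

/-- The discounted optimality equation has a solution. -/
theorem exists_discounted_value [Finite B] [Nonempty B] (M : FiniteMDP I B) {α : ℝ}
    (hα0 : 0 ≤ α) (hα1 : α < 1) :
    ∃ V : I → ℝ, ∀ w, V w = ⨆ b, (M.reward w b + α * ∑ w', M.trans w b w' * V w') := by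
  let F : (I → ℝ) → I → ℝ := fun V w => ⨆ b, (M.reward w b + α * ∑ w', M.trans w b w' * V w')
  have hF : ∀ V W w, F V w ≤ F W w + α * dist V W := fun V W w => ciSup_le fun b => by
    have h1 : M.reward w b + α * ∑ w', M.trans w b w' * W w' ≤ F W w :=
      le_ciSup (f := fun b => M.reward w b + α * ∑ w', M.trans w b w' * W w')
        (Set.finite_range _).bddAbove b
    have h2 := M.sum_trans_mono w b (V := V) (W := fun x => W x + dist V W) fun x => by
      have := (le_abs_self _).trans (dist_le_pi_dist V W x)
      linarith
    rw [sum_trans_add_const] at h2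
    have h3 := mul_le_mul_of_nonneg_left h2 hα0
    linarith
  have hc : ContractingWith ⟨α, hα0⟩ F := by
    refine ⟨by exact_mod_cast hα1, LipschitzWith.of_dist_le_mul fun V W => ?_⟩
    refine (dist_pi_le_iff (mul_nonneg hα0 dist_nonneg)).2 fun w => ?_
    rw [Real.dist_eq, abs_le]
    have h1 := hF V W w
    have h2 := hF W V w
    rw [dist_comm W V] at h2
    change -(α * dist V W) ≤ _ ∧ _ ≤ α * dist V W
    constructor <;> linarith
  exact ⟨hc.fixedPoint, fun w => (congrFun hc.fixedPoint_isFixedPt w).symm⟩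

variable [DecidableEq I]

/-- If a function can only increase by a bounded amount on average in one step, then its growth
along accessible states is controlled. -/
theorem exists_bound_of_accessible (M : FiniteMDP I B) (σ : I → B) {w w' : I}
    (h : MarkovChain.Accessible (M.chain σ) w w') (c K₀ : ℝ) :
    ∃ K, ∀ D : I → ℝ, (∀ x, 0 ≤ D x) → (∀ x, ∑ y, M.trans x (σ x) y * D y ≤ D x + c) →
      D w ≤ K₀ → D w' ≤ K := by
  rw [accessible_iff] at h
  induction h with
  | refl => exact ⟨K₀, fun D _ _ h => h⟩
  | @tail x y _ hxy ih =>
    obtain ⟨K, hK⟩ := ih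
    -- Since `D ≥ 0`, the single term `p(x,y) * D y` is at most the whole average, hence at most `D
    -- x + c`.
    refine ⟨(K + c) / M.trans x (σ x) y, fun D hD hc h0 => ?_⟩
    rw [le_div_iff₀ hxy, mul_comm]
    have h1 := Finset.single_le_sum (f := fun y => M.trans x (σ x) y * D y)
      (fun z _ => mul_nonneg (M.trans_nonneg _ _ _) (hD z)) (Finset.mem_univ y)
    have h2 := hc x
    have h3 := hK D hD hc h0
    linarith

/-- Bounds found for one policy and one pair of states become uniform, as there are finitely many of
these. -/
theorem exists_uniform_bound {ι α : Type*} [Finite ι] {p : ι → α → Prop} {f : ι → α → ℝ}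
    (h : ∀ i, ∃ K, ∀ a, p i a → f i a ≤ K) : ∃ K, ∀ i a, p i a → f i a ≤ K := by
  choose K hK using h
  obtain ⟨L, hL⟩ := (Set.finite_range K).bddAbove
  exact ⟨L, fun i a ha => (hK i a ha).trans (hL ⟨i, rfl⟩)⟩

/-- In a weakly communicating MDP, near-superharmonic functions that are near-subharmonic for some
policy have uniformly bounded oscillation. -/
theorem IsWeaklyCommunicating.exists_span_bound [Finite B] [Nonempty B] {M : FiniteMDP I B}
    (hM : M.IsWeaklyCommunicating) (c : ℝ) :
    ∃ K, ∀ (V : I → ℝ) (σ : I → B), (∀ w b, ∑ w', M.trans w b w' * V w' ≤ V w + c) →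
      (∀ w, V w ≤ ∑ w', M.trans w (σ w) w' * V w' + c) → ∀ w w', V w - V w' ≤ K := by
  obtain ⟨C, -, hacc, htrans⟩ := hM
  have hreach : ∀ (σ : I → B) w, ∃ x ∈ C, MarkovChain.Accessible (M.chain σ) w x := by
    intro σ w
    obtain ⟨x, hx, hr⟩ := M.exists_recurrent σ w
    exact ⟨x, by_contra fun hC => htrans x hC σ hr, hx⟩
  choose e heC he using hreach
  have σ₀ : I → B := fun _ => Classical.arbitrary B
  -- To be used for `D = V - min V`: it is near-superharmonic for all actions, so one may enter `C`
  -- under any policy and then switch to one leading to the desired state of `C`.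
  have hlow : ∀ i : I × C, ∃ K, ∀ D : I → ℝ, ((∀ x, 0 ≤ D x) ∧
      (∀ x b, ∑ y, M.trans x b y * D y ≤ D x + c) ∧ D i.1 ≤ 0) → D i.2 ≤ K := by
    rintro ⟨w, x, hx⟩
    obtain ⟨K₁, h1⟩ := M.exists_bound_of_accessible σ₀ (he σ₀ w) c 0
    obtain ⟨σ, hσ⟩ := hacc _ (heC σ₀ w) x hx
    obtain ⟨K₂, h2⟩ := M.exists_bound_of_accessible σ hσ c K₁
    exact ⟨K₂, fun D ⟨hD, hc, h0⟩ => h2 D hD (fun x => hc x _) (h1 D hD (fun x => hc x _) h0)⟩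
  -- To be used for `D = max V - V`, which is near-superharmonic only under the given policy; that
  -- policy must itself lead into `C`.
  have hup : ∀ i : (I → B) × I, ∃ K, ∀ D : I → ℝ, ((∀ x, 0 ≤ D x) ∧
      (∀ x, ∑ y, M.trans x (i.1 x) y * D y ≤ D x + c) ∧ D i.2 ≤ 0) → D (e i.1 i.2) ≤ K :=
    fun i => by
      obtain ⟨K, hK⟩ := M.exists_bound_of_accessible i.1 (he i.1 i.2) c 0
      exact ⟨K, fun D ⟨hD, hc, h0⟩ => hK D hD hc h0⟩
  obtain ⟨K₁, hK₁⟩ := exists_uniform_bound hlow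
  obtain ⟨K₂, hK₂⟩ := exists_uniform_bound hup
  refine ⟨K₁ + K₂, fun V σ hV hσ w w' => ?_⟩
  have : Nonempty I := ⟨w⟩
  obtain ⟨a, ha⟩ := Finite.exists_min V
  obtain ⟨z, hz⟩ := Finite.exists_max V
  -- The maximum at `z` and the minimum at `a` are compared through the state `e σ z` of `C`.
  have h1 := hK₁ (a, ⟨e σ z, heC σ z⟩) (fun x => V x + -V a)
    ⟨fun x => by linarith [ha x], fun x b => by
      rw [sum_trans_add_const]
      linarith [hV x b], by simp⟩
  have h2 := hK₂ (σ, z) (fun x => -V x + V z)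
    ⟨fun x => by linarith [hz x], fun x => by
      rw [sum_trans_add_const]
      simp only [mul_neg, Finset.sum_neg_distrib]
      linarith [hσ x], by simp⟩
  simp only at h1 h2
  linarith [ha w', hz w]

/-- Normalised discounted values are bounded uniformly in the discount factor, and solve a
perturbed Bellman equation. -/
theorem IsWeaklyCommunicating.exists_approximate_solution [Finite B] [Nonempty B] [Nonempty I]
    {M : FiniteMDP I B} (hM : M.IsWeaklyCommunicating) :
    ∃ K, ∀ α : ℝ, 0 ≤ α → α < 1 → ∃ (θ : ℝ) (h : I → ℝ), |θ| ≤ K ∧ (∀ w, |h w| ≤ K) ∧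
      ∀ w, θ + h w = ⨆ b, (M.reward w b + α * ∑ w', M.trans w b w' * h w') := by
  obtain ⟨R, hR0, hR⟩ := M.exists_abs_reward_le
  -- One `R` bounds the reward, the other the discount defect `(1 - α) * ∑ p V`, since `(1 - α) *
  -- |V| ≤ R`.
  obtain ⟨K, hK⟩ := hM.exists_span_bound (2 * R)
  refine ⟨max K R, fun α hα0 hα1 => ?_⟩
  obtain ⟨V, hV⟩ := M.exists_discounted_value hα0 hα1
  have hle : ∀ w b, M.reward w b + α * ∑ w', M.trans w b w' * V w' ≤ V w := fun w b => by
    rw [hV w]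
    exact le_ciSup (f := fun b => M.reward w b + α * ∑ w', M.trans w b w' * V w')
      (Set.finite_range _).bddAbove b
  have hex : ∀ w, ∃ b, M.reward w b + α * ∑ w', M.trans w b w' * V w' = V w := fun w => by
    rw [hV w]
    exact exists_eq_ciSup_of_finite
  choose σ hσ using hex
  obtain ⟨z, hz⟩ := Finite.exists_max fun w => |V w|
  have hnorm : (1 - α) * |V z| ≤ R := by
    have h1 := abs_add_le (M.reward z (σ z)) (α * ∑ w', M.trans z (σ z) w' * V w')
    rw [hσ z, abs_mul, abs_of_nonneg hα0] at h1
    have h2 := mul_le_mul_of_nonneg_left (M.abs_sum_trans_le z (σ z) hz) hα0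
    linarith [hR z (σ z)]
  have hVR : ∀ w, (1 - α) * |V w| ≤ R := fun w =>
    (mul_le_mul_of_nonneg_left (hz w) (by linarith)).trans hnorm
  have hPR : ∀ w b, |(1 - α) * ∑ w', M.trans w b w' * V w'| ≤ R := fun w b => by
    rw [abs_mul, abs_of_nonneg (by linarith : (0 : ℝ) ≤ 1 - α)]
    exact (mul_le_mul_of_nonneg_left (M.abs_sum_trans_le w b hz) (by linarith)).trans hnorm
  have hspan := hK V σ
    (fun w b => by
      have h1 := hle w b
      have h2 := abs_le.1 (hR w b)
      have h3 := abs_le.1 (hPR w b)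
      linarith)
    (fun w => by
      have h1 := hσ w
      have h2 := abs_le.1 (hR w (σ w))
      have h3 := abs_le.1 (hPR w (σ w))
      linarith)
  obtain ⟨ref⟩ := ‹Nonempty I›
  refine ⟨(1 - α) * V ref, fun w => V w + -V ref, ?_, fun w => ?_, fun w => ?_⟩
  · rw [abs_mul, abs_of_nonneg (by linarith : (0 : ℝ) ≤ 1 - α)]
    exact (hVR ref).trans (le_max_right _ _)
  · refine le_trans ?_ (le_max_left _ _)
    rw [abs_le]
    constructor <;> linarith [hspan w ref, hspan ref w]
  · refine le_antisymm ?_ (ciSup_le fun b => ?_)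
    · refine le_trans (le_of_eq ?_) (le_ciSup (Set.finite_range _).bddAbove (σ w))
      rw [sum_trans_add_const]
      linarith [hσ w]
    · rw [sum_trans_add_const]
      linarith [hle w b]

/-- The Bellman equation of a weakly communicating MDP is solvable. -/
theorem IsWeaklyCommunicating.exists_solvesBellman [Finite B] [Nonempty B] [Nonempty I]
    {M : FiniteMDP I B} (hM : M.IsWeaklyCommunicating) : ∃ θ V, M.SolvesBellman θ V := by
  obtain ⟨K, hK⟩ := hM.exists_approximate_solution
  choose θ h hθ hh heq using fun n : ℕ => hK ((n : ℝ) / (n + 1)) (by positivity)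
    ((div_lt_one (by positivity)).2 (lt_add_one _))
  have hK0 : 0 ≤ K := (abs_nonneg _).trans (hθ 0)
  -- The gains and normalised values lie in a fixed ball, so they converge along a subsequence while
  -- the discount factor tends to one.
  obtain ⟨⟨θ', V⟩, -, φ, hφ, hlim⟩ := tendsto_subseq_of_bounded
    (Metric.isBounded_closedBall (x := (0 : ℝ × (I → ℝ))) (r := K)) (x := fun n => (θ n, h n))
    (fun n => by
      rw [mem_closedBall_zero_iff, Prod.norm_def]
      exact max_le (hθ n) ((pi_norm_le_iff_of_nonneg hK0).2 (hh n)))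
  have hlimθ : Tendsto (fun n => θ (φ n)) atTop (nhds θ') := (continuous_fst.tendsto _).comp hlim
  have hlimV : ∀ w, Tendsto (fun n => h (φ n) w) atTop (nhds (V w)) :=
    fun w => ((continuous_apply w).tendsto _).comp ((continuous_snd.tendsto _).comp hlim)
  have hα : Tendsto (fun n => ((φ n : ℕ) : ℝ) / ((φ n : ℕ) + 1)) atTop (nhds 1) :=
    (tendsto_natCast_div_add_atTop (1 : ℝ)).comp hφ.tendsto_atTop
  refine ⟨θ', V, fun w => ?_⟩
  have := Fintype.ofFinite B
  refine tendsto_nhds_unique (hlimθ.add (hlimV w)) ?_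
  simp only [heq, ← Finset.sup'_univ_eq_ciSup]
  refine Tendsto.finset_sup'_nhds_apply _ fun b _ => ?_
  have h1 := hα.mul (tendsto_finsetSum Finset.univ fun w' _ =>
    (hlimV w').const_mul (M.trans w b w'))
  rw [one_mul] at h1
  exact h1.const_add _

end FiniteMDP

/-! ## Convergence of value iteration under aperiodicity -/

namespace FiniteMDP

variable {I B : Type*} [Fintype I] [DecidableEq I]

/-- An aperiodic recurrent state can be revisited after any sufficiently large time. -/
theorem exists_pow_pos_of_aperiodic (M : FiniteMDP I B) {σ : I → B}
    (hσ : MarkovChain.IsAperiodic (M.chain σ)) {w : I}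
    (hw : MarkovChain.Recurrent (M.chain σ) w) :
    ∃ N, ∀ n ≥ N, 0 < (M.chain σ ^ n) w w := by
  let s : Set ℕ := {n | 0 < n ∧ 0 < (M.chain σ ^ n) w w}
  -- Every large multiple of the gcd of the return times is a sum of return times, and such sums are
  -- again times of positive return probability.
  obtain ⟨N, hN⟩ := Nat.exists_mem_closure_of_ge s
  refine ⟨N, fun n hn => ?_⟩
  have hgcd : Nat.setGcd s = 1 := hσ w hw _ fun n h0 h1 => Nat.setGcd_dvd_of_mem ⟨h0, h1⟩
  have hmem := hN n hn (hgcd ▸ one_dvd n)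
  clear hn
  induction hmem using AddSubmonoid.closure_induction with
  | mem n hn => exact hn.2
  | zero => simp
  | add a b _ _ ha hb =>
    rw [pow_add, Matrix.mul_apply]
    exact Finset.sum_pos' (fun z _ => mul_nonneg (M.chain_pow_nonneg _ _ _ _)
      (M.chain_pow_nonneg _ _ _ _)) ⟨w, Finset.mem_univ _, mul_pos ha hb⟩

/-- All states communicating with an aperiodic recurrent state can reach it simultaneously, with
probability bounded away from zero. -/
theorem exists_pow_ge_of_aperiodic (M : FiniteMDP I B) {σ : I → B}
    (hσ : MarkovChain.IsAperiodic (M.chain σ)) {w : I}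
    (hw : MarkovChain.Recurrent (M.chain σ) w) :
    ∃ m p, 0 < p ∧ ∀ x, MarkovChain.Accessible (M.chain σ) w x → p ≤ (M.chain σ ^ m) x w := by
  obtain ⟨N, hN⟩ := M.exists_pow_pos_of_aperiodic hσ hw
  have hx : ∀ x, ∃ n, MarkovChain.Accessible (M.chain σ) w x → 0 < (M.chain σ ^ n) x w :=
    fun x => by
      by_cases h : MarkovChain.Accessible (M.chain σ) w x
      · obtain ⟨n, hn⟩ := hw x h
        exact ⟨n, fun _ => hn⟩
      · exact ⟨0, fun h' => absurd h' h⟩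
  choose n hn using hx
  obtain ⟨L, hL⟩ := (Set.finite_range n).bddAbove
  have hpos : ∀ x, MarkovChain.Accessible (M.chain σ) w x → 0 < (M.chain σ ^ (N + L)) x w :=
    fun x h => by
      have hle : n x ≤ L := hL ⟨x, rfl⟩
      -- Go to `w` in `n x` steps, then return to `w` after the remaining time, which is at least
      -- `N`; all states thus share the time `N + L`.
      rw [show N + L = n x + (N + (L - n x)) by omega, pow_add, Matrix.mul_apply]
      exact Finset.sum_pos' (fun z _ => mul_nonneg (M.chain_pow_nonneg _ _ _ _)
        (M.chain_pow_nonneg _ _ _ _))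
        ⟨w, Finset.mem_univ _, mul_pos (hn x h) (hN _ (Nat.le_add_right _ _))⟩
  obtain ⟨K, hK⟩ := (Set.finite_range fun x => ((M.chain σ ^ (N + L)) x w)⁻¹).bddAbove
  have hw0 := hpos w ⟨0, by simp⟩
  have hK0 : 0 < K := (inv_pos.2 hw0).trans_le (hK ⟨w, rfl⟩)
  exact ⟨N + L, K⁻¹, inv_pos.2 hK0, fun x h => inv_le_of_inv_le₀ (hpos x h) (hK ⟨x, rfl⟩)⟩

/-- Maximum principle: a subharmonic function equals its maximum at all states accessible from a
maximiser. -/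
theorem eq_of_subharmonic (M : FiniteMDP I B) {σ : I → B} {D : I → ℝ} {E : I → Prop}
    (hE : ∀ x y, E x → 0 < M.trans x (σ x) y → E y)
    (hD : ∀ x, E x → D x ≤ ∑ y, M.trans x (σ x) y * D y) {w : I} (hwE : E w)
    (hmax : ∀ x, E x → D x ≤ D w) {w' : I} (h : MarkovChain.Accessible (M.chain σ) w w') :
    E w' ∧ D w' = D w := by
  rw [accessible_iff] at h
  induction h with
  | refl => exact ⟨hwE, rfl⟩
  | @tail x y _ hxy ih =>
    obtain ⟨hxE, hx⟩ := ih
    refine ⟨hE x y hxE hxy, (hmax y (hE x y hxE hxy)).antisymm (not_lt.1 fun hlt => ?_)⟩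
    have h1 : ∑ z, M.trans x (σ x) z * D z < ∑ z, M.trans x (σ x) z * D w :=
      Finset.sum_lt_sum (fun z _ => by
        rcases (M.trans_nonneg x (σ x) z).eq_or_lt with h0 | h0
        · simp [← h0]
        · exact mul_le_mul_of_nonneg_left (hmax z (hE x z hxE h0)) h0.le)
        ⟨y, Finset.mem_univ _, mul_lt_mul_of_pos_left hlt hxy⟩
    rw [sum_trans_const] at h1
    linarith [hD x hxE]

omit [DecidableEq I] in
theorem sum_trans_le_of_forall_pos (M : FiniteMDP I B) (w : I) (b : B) {V W : I → ℝ}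
    (h : ∀ x, 0 < M.trans w b x → V x ≤ W x) :
    ∑ w', M.trans w b w' * V w' ≤ ∑ w', M.trans w b w' * W w' :=
  Finset.sum_le_sum fun x _ => by
    rcases (M.trans_nonneg w b x).eq_or_lt with h0 | h0
    · simp [← h0]
    · exact mul_le_mul_of_nonneg_left (h x h0) h0.le

/-- Along a closed set on which `x` is superharmonic in time, mass near a high value at `w` spreads
over the whole set. -/
theorem spread_le (M : FiniteMDP I B) {σ : I → B} {x : ℕ → I → ℝ} {E : I → Prop}
    (hE : ∀ y z, E y → 0 < M.trans y (σ y) z → E z)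
    (hx : ∀ n y, E y → ∑ z, M.trans y (σ y) z * x n z ≤ x (n + 1) y) {n : ℕ} {a d : ℝ} {w : I}
    (ha : ∀ y, E y → a ≤ x n y) (hd : a + d ≤ x n w) (m : ℕ) (y : I) (hy : E y) :
    a + (M.chain σ ^ m) y w * d ≤ x (n + m) y := by
  induction m generalizing y with
  | zero =>
    by_cases h : y = w
    · subst h; simpa using hd
    · simpa [Matrix.one_apply_ne h] using ha y hy
  | succ m ih =>
    refine le_trans (le_of_eq ?_) ((M.sum_trans_le_of_forall_pos y (σ y)
      (V := fun z => a + (M.chain σ ^ m) z w * d) fun z hz => ih z (hE y z hy hz)).trans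
        (hx (n + m) y hy))
    rw [pow_succ', Matrix.mul_apply, Finset.sum_mul]
    simp only [mul_add, Finset.sum_add_distrib, sum_trans_const, mul_assoc]
    rfl

omit [DecidableEq I] in
/-- If the rewards are nonpositive and a zero reward is available everywhere, then value iteration
stays bounded. -/
theorem exists_abs_iterate_le [Finite B] [Nonempty B] (M : FiniteMDP I B)
    (hr : ∀ w b, M.reward w b ≤ 0) (hr0 : ∀ w, ∃ b, M.reward w b = 0) {x : ℕ → I → ℝ}
    (hx : ∀ n w, x (n + 1) w = M.backup (x n) w) : ∃ K, ∀ n w, |x n w| ≤ K := by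
  obtain ⟨K, hK⟩ := (Set.finite_range fun w => |x 0 w|).bddAbove
  refine ⟨K, fun n => ?_⟩
  induction n with
  | zero => exact fun w => hK ⟨w, rfl⟩
  | succ n ih =>
    intro w
    rw [hx, abs_le]
    constructor
    · obtain ⟨b, hb⟩ := hr0 w
      have h1 := M.lookahead_le_backup (x n) w b
      have h2 := (abs_le.1 (M.abs_sum_trans_le w b ih)).1
      rw [lookahead, hb] at h1
      linarith
    · refine ciSup_le fun b => ?_
      have h2 := (abs_le.1 (M.abs_sum_trans_le w b ih)).2
      rw [lookahead]
      linarith [hr w b]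

/-- Value iteration converges for an aperiodic MDP whose rewards are nonpositive, with a zero reward
available everywhere. -/
theorem IsAperiodic.tendsto_iterate [Finite B] [Nonempty B] {M : FiniteMDP I B}
    (hM : M.IsAperiodic) (hr : ∀ w b, M.reward w b ≤ 0) (hr0 : ∀ w, ∃ b, M.reward w b = 0)
    {x : ℕ → I → ℝ} (hx : ∀ n w, x (n + 1) w = M.backup (x n) w) :
    ∃ u : I → ℝ, ∀ w, Tendsto (fun n => x n w) atTop (nhds (u w)) := by
  obtain ⟨K, hK⟩ := M.exists_abs_iterate_le hr hr0 hx
  have hba : ∀ w, IsBoundedUnder (· ≤ ·) atTop fun n => x n w :=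
    fun w => isBoundedUnder_of ⟨K, fun n => (abs_le.1 (hK n w)).2⟩
  have hbb : ∀ w, IsBoundedUnder (· ≥ ·) atTop fun n => x n w :=
    fun w => isBoundedUnder_of ⟨-K, fun n => (abs_le.1 (hK n w)).1⟩
  let u : I → ℝ := fun w => limsup (fun n => x n w) atTop
  let l : I → ℝ := fun w => liminf (fun n => x n w) atTop
  have hlu : ∀ w, l w ≤ u w := fun w => liminf_le_limsup (hba w) (hbb w)
  have hu : ∀ η > 0, ∀ᶠ n in atTop, ∀ w, x n w ≤ u w + η := fun η hη =>
    eventually_all.2 fun w => (eventually_lt_of_limsup_lt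
      (lt_add_of_pos_right (u w) hη) (hba w)).mono fun n h => h.le
  have hl : ∀ η > 0, ∀ᶠ n in atTop, ∀ w, l w - η ≤ x n w := fun η hη =>
    eventually_all.2 fun w => (eventually_lt_of_lt_liminf
      (sub_lt_self (l w) hη) (hbb w)).mono fun n h => h.le
  have hle_l : ∀ w a, (∀ᶠ n in atTop, a ≤ x n w) → a ≤ l w := fun w a h =>
    le_liminf_of_le (hba w).isCoboundedUnder_ge h
  have hTu : ∀ w, u w ≤ M.backup u w := fun w => by
    refine le_of_forall_pos_le_add fun η hη => ?_
    refine limsup_le_of_le (hbb w).isCoboundedUnder_le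
      ((eventually_ge_atTop 1).and ((tendsto_sub_atTop_nat 1).eventually (hu η hη)) |>.mono ?_)
    rintro n ⟨hn, h⟩
    obtain ⟨k, rfl⟩ := Nat.exists_eq_add_of_le' hn
    rw [hx, ← backup_add_const]
    exact M.backup_mono h w
  have hTl : ∀ w b, M.lookahead l w b ≤ l w := fun w b => by
    refine le_of_forall_pos_sub_le fun η hη => ?_
    refine hle_l w _
      ((eventually_ge_atTop 1).and ((tendsto_sub_atTop_nat 1).eventually (hl η hη)) |>.mono ?_)
    rintro n ⟨hn, h⟩
    obtain ⟨k, rfl⟩ := Nat.exists_eq_add_of_le' hn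
    rw [hx, sub_eq_add_neg, ← lookahead_add_const]
    exact (M.lookahead_mono h w b).trans (M.lookahead_le_backup _ w b)
  obtain ⟨σ, hσ⟩ := M.exists_isGreedy u
  have hσu : ∀ w, u w ≤ M.lookahead u w (σ w) := fun w => (hσ.lookahead_eq w) ▸ hTu w
  -- `u` is a subsolution under `σ` and `l` a supersolution for every action; at the same action the
  -- rewards cancel.
  have hD : ∀ w, u w - l w ≤ ∑ y, M.trans w (σ w) y * (u y - l y) := fun w => by
    have h1 := hσu w
    have h2 := hTl w (σ w)
    simp only [lookahead, mul_sub, Finset.sum_sub_distrib] at *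
    linarith
  suffices h : ∀ w, u w ≤ l w from
    ⟨u, fun w => tendsto_of_liminf_eq_limsup ((hlu w).antisymm (h w)) rfl (hba w) (hbb w)⟩
  intro w₀
  by_contra! hw₀
  have : Nonempty I := ⟨w₀⟩
  obtain ⟨z, hz⟩ := Finite.exists_max fun w => u w - l w
  obtain ⟨e, hze, he⟩ := M.exists_recurrent σ z
  let E : I → Prop := MarkovChain.Accessible (M.chain σ) e
  have hEe : E e := ⟨0, by simp⟩
  have hE : ∀ x y, E x → 0 < M.trans x (σ x) y → E y := fun x y hx hxy => by
    simp only [E, accessible_iff] at *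
    exact hx.tail hxy
  have hEacc : ∀ x y, E x → E y → MarkovChain.Accessible (M.chain σ) x y := fun x y hx hy => by
    have h := he x hx
    simp only [E, accessible_iff] at *
    exact h.trans hy
  have hDE : ∀ x, E x → u x - l x = u z - l z := fun x hx =>
    (M.eq_of_subharmonic (E := fun _ => True) (fun _ _ _ _ => trivial) (fun x _ => hD x)
      trivial (fun x _ => hz x) (by
        have h : E x := hx
        simp only [E, accessible_iff] at *
        exact hze.trans h)).2
  have hd : 0 < u z - l z := by linarith [hz w₀]
  -- Nonpositive rewards make `u` subharmonic, hence constant on the recurrent class `E`, which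
  -- forces the rewards there to vanish.
  have husub : ∀ x, E x → u x ≤ ∑ y, M.trans x (σ x) y * u y := fun x _ => by
    have := hσu x
    rw [lookahead] at this
    linarith [hr x (σ x)]
  classical
  obtain ⟨f, hf, hfmax⟩ := Finset.exists_max_image (Finset.univ.filter E) u ⟨e, by simpa using hEe⟩
  simp only [Finset.mem_filter, Finset.mem_univ, true_and] at hf hfmax
  have huE : ∀ x, E x → u x = u f := fun x hx =>
    (M.eq_of_subharmonic hE husub hf hfmax (hEacc f x hf hx)).2
  have hrE : ∀ x, E x → 0 ≤ M.reward x (σ x) := fun x hx => by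
    have h1 := hσu x
    have h2 := M.sum_trans_le_of_forall_pos x (σ x) (V := u) (W := fun _ => u f)
      fun y hy => (huE y (hE x y hx hy)).le
    rw [sum_trans_const] at h2
    rw [lookahead] at h1
    linarith [huE x hx]
  have hxE : ∀ n y, E y → ∑ z, M.trans y (σ y) z * x n z ≤ x (n + 1) y := fun n y hy => by
    have h1 := M.lookahead_le_backup (x n) y (σ y)
    rw [hx]
    rw [lookahead] at h1
    linarith [hrE y hy]
  obtain ⟨m, p, hp, hm⟩ := M.exists_pow_ge_of_aperiodic (hM σ) he
  set d := u z - l z with hd_def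
  have hlE : ∀ x, E x → l x = u f - d := fun x hx => by linarith [hDE x hx, huE x hx]
  -- At some late time the iterate is above `u - η` at `e` and at least `l - η` on `E`. Mixing for
  -- `m` steps raises all of `E` by at least `p * d`, more than the loss `η`, and the gain persists.
  obtain ⟨η, hη0, hη⟩ : ∃ η, 0 < η ∧ η < p * d := exists_between (by positivity)
  have hfreq : ∃ᶠ n in atTop, u e - η < x n e :=
    frequently_lt_of_lt_limsup (hbb e).isCoboundedUnder_le (sub_lt_self (u e) hη0)
  obtain ⟨n, hn1, hn2⟩ := (hfreq.and_eventually (hl η hη0)).exists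
  have hspread : ∀ y, E y → u f - d - η + p * d ≤ x (n + m) y := fun y hy => by
    have h1 := M.spread_le hE hxE (a := u f - d - η) (d := d) (w := e) (n := n)
      (fun y hy => by linarith [hn2 y, hlE y hy]) (by linarith [huE e hEe]) m y hy
    have h2 := mul_le_mul_of_nonneg_right (hm y hy) hd.le
    linarith
  have hstay : ∀ j y, E y → u f - d - η + p * d ≤ x (n + m + j) y := fun j => by
    induction j with
    | zero => exact hspread
    | succ j ih =>
      intro y hy
      have h1 := M.sum_trans_le_of_forall_pos y (σ y) (V := fun _ => u f - d - η + p * d)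
        fun z hz => ih z (hE y z hy hz)
      rw [sum_trans_const] at h1
      exact h1.trans (hxE _ y hy)
  have hfin := hle_l e (u f - d - η + p * d) (by
    filter_upwards [eventually_ge_atTop (n + m)] with k hk
    obtain ⟨j, rfl⟩ := Nat.exists_eq_add_of_le hk
    exact hstay j e hEe)
  linarith [hlE e hEe]

end FiniteMDP

/-! ## Gains of policies and relative value iteration -/

namespace FiniteMDP

variable {I B : Type*} [Fintype I]

theorem chain_nonneg (M : FiniteMDP I B) (σ : I → B) (w w' : I) : 0 ≤ M.chain σ w w' :=
  M.trans_nonneg w (σ w) w'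

theorem chain_sum (M : FiniteMDP I B) (σ : I → B) (w : I) : ∑ w', M.chain σ w w' = 1 :=
  M.trans_sum w (σ w)

/-- The long-run average cost of a deterministic stationary policy. -/
noncomputable def policyCost (M : FiniteMDP I B) (μ : I → ℝ) (σ : I → B) : ℝ :=
  MarkovChain.longRunAverage (M.chain σ) μ fun w => -M.reward w (σ w)

/-- Costs are negated rewards, so `-V` serves as the telescoping function. -/
theorem policyCost_le (M : FiniteMDP I B) {μ : I → ℝ} (hμ : μ ∈ stdSimplex ℝ I) {σ : I → B}
    {κ : ℝ} {V : I → ℝ} (h : ∀ w, κ + V w ≤ M.lookahead V w (σ w)) :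
    M.policyCost μ σ ≤ -κ := by
  refine MarkovChain.longRunAverage_le (V := fun w => -V w) (M.chain_nonneg σ)
    (M.chain_sum σ) hμ fun w => ?_
  have h1 := h w
  simp only [lookahead] at h1
  simp only [chain, Matrix.of_apply, mul_neg, Finset.sum_neg_distrib]
  linarith

theorem le_policyCost (M : FiniteMDP I B) {μ : I → ℝ} (hμ : μ ∈ stdSimplex ℝ I) (σ : I → B)
    {κ : ℝ} {V : I → ℝ} (h : ∀ w b, M.lookahead V w b ≤ κ + V w) :
    -κ ≤ M.policyCost μ σ := by
  refine MarkovChain.le_longRunAverage (V := fun w => -V w) (M.chain_nonneg σ)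
    (M.chain_sum σ) hμ fun w => ?_
  have h1 := h w (σ w)
  simp only [lookahead] at h1
  simp only [chain, Matrix.of_apply, mul_neg, Finset.sum_neg_distrib]
  linarith

variable [Finite B] [Nonempty B]

theorem SolvesBellman.policyCost_le {M : FiniteMDP I B} {θ : ℝ} {V : I → ℝ}
    (h : M.SolvesBellman θ V) {σ : I → B} (hσ : M.IsGreedy V σ) {μ : I → ℝ}
    (hμ : μ ∈ stdSimplex ℝ I) : M.policyCost μ σ ≤ -θ :=
  M.policyCost_le hμ fun w => ((h w).trans (hσ.lookahead_eq w).symm).le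

omit [Nonempty B] in
theorem SolvesBellman.le_policyCost {M : FiniteMDP I B} {θ : ℝ} {V : I → ℝ}
    (h : M.SolvesBellman θ V) (σ : I → B) {μ : I → ℝ} (hμ : μ ∈ stdSimplex ℝ I) :
    -θ ≤ M.policyCost μ σ :=
  M.le_policyCost hμ σ fun w b => (M.lookahead_le_backup V w b).trans (h w).ge

variable [DecidableEq I]

omit [Finite B] [Nonempty B] in
theorem rvi_ref (M : FiniteMDP I B) (ref : I) (k : ℕ) : M.rvi ref k ref = 0 := by
  cases k <;> simp [rvi]

omit [Finite B] [Nonempty B] in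
theorem rviBackup_eq (M : FiniteMDP I B) {ref : I} {V : I → ℝ} (hV : V ref = 0) (w : I) :
    M.rviBackup ref V w = M.backup V w := by
  refine iSup_congr fun b => ?_
  rw [lookahead, Finset.sum_erase _ (by rw [hV, mul_zero])]

omit [Finite B] [Nonempty B] in
theorem rvi_succ (M : FiniteMDP I B) (ref : I) (k : ℕ) (w : I) :
    M.rvi ref (k + 1) w = M.backup (M.rvi ref k) w - M.backup (M.rvi ref k) ref := by
  simp only [rvi, M.rviBackup_eq (M.rvi_ref ref k)]
  split_ifs with h
  · rw [h, sub_self]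
  · ring

/-- Undiscounted value iteration started at `0`. -/
noncomputable def valueIterate (M : FiniteMDP I B) : ℕ → I → ℝ
  | 0 => fun _ => 0
  | k + 1 => M.backup (valueIterate M k)

/-- The backup commutes with adding constants, so normalising at each pass amounts to a single shift
at the end. -/
theorem rvi_eq (M : FiniteMDP I B) (ref : I) (k : ℕ) :
    M.rvi ref k = fun w => M.valueIterate k w + -M.valueIterate k ref := by
  induction k with
  | zero => funext w; simp [rvi, valueIterate]
  | succ k ih =>
    funext w
    rw [rvi_succ, ih, backup_add_const, backup_add_const, valueIterate]
    ring

/-- When relative value iteration stops, the last iterate nearly solves the Bellman equation. -/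
theorem RVIStopsAt.exists_gain {M : FiniteMDP I B} {ref : I} {ε : ℝ} {k : ℕ}
    (h : M.RVIStopsAt ref ε k) :
    ∃ g, ∀ w, |M.backup (M.rvi ref k) w - M.rvi ref k w - g| ≤ ε := by
  obtain ⟨hk, hlt, -⟩ := h
  obtain ⟨j, rfl⟩ := Nat.exists_eq_add_of_le' hk
  rw [Nat.add_sub_cancel] at hlt
  have hx : ∀ x, |M.rvi ref (j + 1) x - M.rvi ref j x| ≤ ε := fun x =>
    (norm_le_pi_norm (M.rvi ref (j + 1) - M.rvi ref j) x).trans hlt.le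
  -- With the offset of the last pass as gain, the Bellman residual of the last iterate is the
  -- difference of the backups of the last two iterates, and the backup is nonexpansive.
  refine ⟨M.backup (M.rvi ref j) ref, fun w => ?_⟩
  have h1 := M.backup_mono (V := M.rvi ref (j + 1)) (W := fun x => M.rvi ref j x + ε)
    (fun x => by linarith [(abs_le.1 (hx x)).2]) w
  have h2 := M.backup_mono (V := M.rvi ref j) (W := fun x => M.rvi ref (j + 1) x + ε)
    (fun x => by linarith [(abs_le.1 (hx x)).1]) w
  rw [backup_add_const] at h1 h2
  have h3 := M.rvi_succ ref j w
  rw [abs_le]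
  constructor <;> linarith

/-- The sampling policy returned by relative value iteration is nearly optimal, and the returned
average reward is nearly the optimal one. -/
theorem IsRVIOutput.near_optimal {M : FiniteMDP I B} {ref : I} {ε : ℝ} {σ : I → B} {θ : ℝ}
    (h : M.IsRVIOutput ref ε σ θ) {μ : I → ℝ} (hμ : μ ∈ stdSimplex ℝ I) :
    M.policyCost μ σ ≤ -θ + 2 * ε ∧ ∀ σ', -θ ≤ M.policyCost μ σ' + 2 * ε := by
  obtain ⟨k, hk, ⟨w, hw⟩, hσ⟩ := h
  obtain ⟨g, hg⟩ := hk.exists_gain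
  have hw' : θ = -M.rvi ref k w + M.backup (M.rvi ref k) w := hw
  -- One `ε` is lost between `θ` and `g`, the other between `g` and the policy costs.
  have hθ := abs_le.1 (hg w)
  constructor
  · have := M.policyCost_le hμ (σ := σ) (κ := g - ε) (V := M.rvi ref k) fun x => by
      rw [hσ.lookahead_eq]
      linarith [(abs_le.1 (hg x)).1]
    linarith
  · intro σ'
    have := M.le_policyCost hμ σ' (κ := g + ε) (V := M.rvi ref k) fun x b => by
      linarith [(abs_le.1 (hg x)).2, M.lookahead_le_backup (M.rvi ref k) x b]
    linarith

/-- The increments of value iteration converge to the optimal gain when all induced chains are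
aperiodic. -/
theorem IsAperiodic.tendsto_valueIterate_sub {M : FiniteMDP I B} (hM : M.IsAperiodic) {θ : ℝ}
    {h : I → ℝ} (hB : M.SolvesBellman θ h) (w : I) :
    Tendsto (fun n => M.valueIterate (n + 1) w - M.valueIterate n w) atTop (nhds θ) := by
  -- The new reward is the Bellman defect of `(θ, h)`: nonpositive, and zero at actions greedy for
  -- `h`. Value iteration for `N` started at `-h` produces `v_n - h - n * θ`.
  let N : FiniteMDP I B :=
    { M with reward := fun w b => M.lookahead h w b + (-h w - θ) }
  have hN : N.IsAperiodic := hM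
  have hlook : ∀ (y : I → ℝ) w b,
      N.lookahead y w b = M.lookahead (fun z => y z + h z) w b + (-h w - θ) := fun y w b => by
    simp only [lookahead, N, mul_add, Finset.sum_add_distrib]
    ring
  have hback : ∀ (y : I → ℝ) w, N.backup y w = M.backup (fun z => y z + h z) w + (-h w - θ) :=
    fun y w => by
      refine le_antisymm (ciSup_le fun b => ?_) ?_
      · rw [hlook y]
        exact add_le_add_left (M.lookahead_le_backup _ w b) _
      · obtain ⟨b, hb⟩ := M.exists_lookahead_eq_backup (fun z => y z + h z) w
        rw [← hb, ← hlook y]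
        exact N.lookahead_le_backup y w b
  have hbell : ∀ w, θ + h w = M.backup h w := hB
  obtain ⟨u, hu⟩ := hN.tendsto_iterate
    (fun w b => by
      change M.lookahead h w b + (-h w - θ) ≤ 0
      linarith [hbell w, M.lookahead_le_backup h w b])
    (fun w => by
      obtain ⟨b, hb⟩ := M.exists_lookahead_eq_backup h w
      refine ⟨b, ?_⟩
      change M.lookahead h w b + (-h w - θ) = 0
      linarith [hbell w])
    (x := fun n w => M.valueIterate n w + (-h w - n * θ)) (fun n w => by
      rw [hback, show (fun z => M.valueIterate n z + (-h z - n * θ) + h z) =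
        fun z => M.valueIterate n z + -(n * θ) by funext z; ring, backup_add_const, valueIterate]
      push_cast
      ring)
  have h1 := (((hu w).comp (tendsto_add_atTop_nat 1)).sub (hu w)).add_const θ
  rw [sub_self, zero_add] at h1
  refine h1.congr fun n => ?_
  simp only [Function.comp_apply]
  push_cast
  ring

/-- Relative value iteration stops when all induced chains are aperiodic and the Bellman equation is
solvable. -/
theorem IsAperiodic.exists_isRVIOutput {M : FiniteMDP I B} (hM : M.IsAperiodic) {θ : ℝ}
    {h : I → ℝ} (hB : M.SolvesBellman θ h) (ref : I) {ε : ℝ} (hε : 0 < ε) :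
    ∃ σ θ', M.IsRVIOutput ref ε σ θ' := by
  -- The increments at `w` and at `ref` tend to the same `θ`, as the gain is constant in the state.
  have hlim : ∀ w, Tendsto (fun n => M.rvi ref (n + 1) w - M.rvi ref n w) atTop (nhds 0) :=
    fun w => by
      have h1 := (hM.tendsto_valueIterate_sub hB w).sub (hM.tendsto_valueIterate_sub hB ref)
      rw [sub_self] at h1
      refine h1.congr fun n => ?_
      rw [rvi_eq, rvi_eq]
      ring
  obtain ⟨n, hn⟩ := (eventually_all.2 fun w =>
    (hlim w).eventually (Metric.ball_mem_nhds 0 hε)).exists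
  classical
  have hex : ∃ k, 1 ≤ k ∧ ‖M.rvi ref k - M.rvi ref (k - 1)‖ < ε :=
    ⟨n + 1, Nat.le_add_left 1 n, (pi_norm_lt_iff hε).2 fun w => mem_ball_zero_iff.1 (hn w)⟩
  obtain ⟨σ, hσ⟩ := M.exists_isGreedy (M.rvi ref (Nat.find hex))
  refine ⟨σ, _, Nat.find hex, ⟨(Nat.find_spec hex).1, (Nat.find_spec hex).2, fun j hj hlt => ?_⟩,
    ⟨ref, rfl⟩, hσ⟩
  exact not_lt.1 fun hjε => Nat.find_min hex hlt ⟨hj, hjε⟩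

end FiniteMDP

/-! ## Optimality of the brute-force search -/

/-- Each value above `c` excludes only the large `δ`, and there are finitely many values. This turns
near-optimality into optimality. -/
theorem exists_gap_above {ι : Type*} [Finite ι] (f : ι → ℝ) (c : ℝ) :
    ∃ δ, 0 < δ ∧ ∀ i, f i < c + δ → f i ≤ c := by
  have h : ∀ i, ∀ᶠ δ in nhdsWithin (0 : ℝ) (Set.Ioi 0), f i < c + δ → f i ≤ c := fun i => by
    by_cases hi : f i ≤ c
    · exact Eventually.of_forall fun _ _ => hi
    · filter_upwards [Ioo_mem_nhdsGT (sub_pos.2 (not_le.1 hi))] with δ hδ h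
      linarith [hδ.2]
  obtain ⟨δ, hδ, h0⟩ := ((eventually_all.2 h).and self_mem_nhdsWithin).exists
  exact ⟨δ, h0, hδ⟩

namespace GoTModel

variable {S V A : Type*} [Fintype S] [DecidableEq S] [Fintype V] [DecidableEq V]

theorem avgCost_eq (M : GoTModel S V A) (μ : State S V → ℝ) (πS : SamplingPolicy S V)
    (πA : DecisionPolicy S A) : M.avgCost μ πS πA = (M.samplingMDP πA).policyCost μ πS := by
  have hP : M.jointChain πS πA = (M.samplingMDP πA).chain πS := by
    ext w w'
    exact (M.inducedTrans_eq πA w (πS w) w').symm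
  simp only [avgCost, FiniteMDP.policyCost, hP, samplingMDP, neg_neg]

omit [DecidableEq S] [Fintype V] [DecidableEq V] in
theorem exists_isSearchResult [Finite A] [Nonempty A]
    (σ : DecisionPolicy S A → SamplingPolicy S V) (θ : DecisionPolicy S A → ℝ) :
    ∃ πS πA, IsSearchResult σ θ πS πA := by
  obtain ⟨πA, h⟩ := Finite.exists_min fun πA => -θ πA
  exact ⟨σ πA, πA, h, rfl⟩

end GoTModel

theorem mainTheorem1 {S V A : Type*}
    [Fintype S] [DecidableEq S] [Nonempty S]
    [Fintype V] [DecidableEq V] [Nonempty V]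
    [Finite A] [Nonempty A]
    (M : GoTModel S V A)
    (hchain : ∀ πA : GoTModel.DecisionPolicy S A, (M.samplingMDP πA).IsWeaklyCommunicating) :
    -- with exact solutions of the inner problems: there is an output, and every output is optimal
    (∃ πS πA, M.IsExactBruteForceOutput πS πA) ∧
    (∀ πS πA, M.IsExactBruteForceOutput πS πA → M.IsOptimal πS πA) ∧
    -- with relative value iteration: for small tolerances every output is optimal
    (∃ ε₀ : ℝ, 0 < ε₀ ∧ ∀ ε : ℝ, 0 < ε → ε < ε₀ → ∀ ref πS πA,
      M.IsRVIBruteForceOutput ref ε πS πA → M.IsOptimal πS πA) ∧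
    -- and it terminates with an output for every tolerance if the chains are aperiodic
    ((∀ πA : GoTModel.DecisionPolicy S A, (M.samplingMDP πA).IsAperiodic) →
      ∀ ε : ℝ, 0 < ε → ∀ ref, ∃ πS πA, M.IsRVIBruteForceOutput ref ε πS πA) := by
  have hBex := fun πA => (hchain πA).exists_solvesBellman
  choose θB VB hB using hBex
  choose σB hσB using fun πA => (M.samplingMDP πA).exists_isGreedy (VB πA)
  refine ⟨?_, ?_, ?_, ?_⟩
  · obtain ⟨πS, πA, h⟩ := GoTModel.exists_isSearchResult σB θB
    exact ⟨πS, πA, σB, θB, fun πA' => ⟨VB πA', hB πA', hσB πA'⟩, h⟩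
  · rintro πS πA ⟨σ, θ, h, hmin, rfl⟩ μ hμ πS' πA'
    obtain ⟨V₁, hV₁, hσ₁⟩ := h πA
    obtain ⟨V₂, hV₂, -⟩ := h πA'
    rw [M.avgCost_eq, M.avgCost_eq]
    exact (hV₁.policyCost_le hσ₁ hμ).trans ((hmin πA').trans (hV₂.le_policyCost πS' hμ))
  · obtain ⟨πB, hπB⟩ := Finite.exists_max θB
    -- Only point masses are used as initial laws, to keep the family of costs finite; general laws
    -- follow by averaging.
    obtain ⟨δ, hδ, hgap⟩ := exists_gap_above
      (fun p : GoTModel.DecisionPolicy S A × GoTModel.SamplingPolicy S V × GoTModel.State S V =>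
        (M.samplingMDP p.1).policyCost (Pi.single p.2.2 1) p.2.1) (-θB πB)
    -- An error of `2 * ε` arises at the selected policy and another `2 * ε` at the truly optimal
    -- `πB`.
    refine ⟨δ / 4, by positivity, ?_⟩
    rintro ε - hε ref πS πA ⟨σ, θ, h, hmin, rfl⟩ μ hμ πS' πA'
    rw [M.avgCost_eq, M.avgCost_eq]
    have hsingle : ∀ w, (M.samplingMDP πA).policyCost (Pi.single w 1) (σ πA) ≤ -θB πB :=
      fun w => hgap (πA, σ πA, w) (by
        have hw := single_mem_stdSimplex ℝ w
        have h1 := ((h πA).near_optimal hw).1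
        have h2 := ((h πB).near_optimal hw).2 (σB πB)
        have h3 := (hB πB).policyCost_le (hσB πB) hw
        have h4 := hmin πB
        simp only
        linarith)
    have h1 : (M.samplingMDP πA).policyCost μ (σ πA) ≤ -θB πB :=
      MarkovChain.longRunAverage_le_of_forall_single
        ((M.samplingMDP πA).chain_nonneg _) ((M.samplingMDP πA).chain_sum _) hsingle hμ
    have h2 := (hB πA').le_policyCost πS' hμ
    linarith [hπB πA']
  · intro hap ε hε ref
    choose σ θ h using fun πA => (hap πA).exists_isRVIOutput (hB πA) (ref πA) hε
    obtain ⟨πS, πA, hres⟩ := GoTModel.exists_isSearchResult σ θ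
    exact ⟨πS, πA, σ, θ, h, hres⟩
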